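/- Let $A$ be a unital $C^*$-algebra with self-adjoint part $\operatorname{Re}A$. An \emph{isocone} of $A$ is a norm-closed subset $I\subseteq\operatorname{Re}A$ that contains $r\cdot 1$ for every $r\in\mathbb R$, is stable under addition, satisfies $f(a)\in I$ for every $a\in I$ and every continuous non-decreasing $f:\mathbb R\to\mathbb R$ (continuous functional calculus), and satisfies $\overline{I-I}=\operatorname{Re}A$. For states $\varphi,\psi$ of $A$ write $\varphi\le_I\psi$ iff $\varphi(a)\le\psi(a)$ for all $a\in I$. Let $M$ be a compact Hausdorff space, let $n\ge 1$, and let $A=\mathcal C(M)\otimes M_n(\mathbb C)\cong\mathcal C(M,M_n(\mathbb C))$. For $x\in M$ and $\xi\in\mathbb CP^{n-1}$ (represented by a unit vector) let $\xi$ also denote the pure state $a\mapsto\xi^\dagger a\,\xi$ of $M_n(\mathbb C)$, and let $(x,\xi)$ denote the pure state $F\mapsto\xi^\dagger F(x)\,\xi$ of $A$. Let $I$ be an isocone of $A$, and for $x\in M$ put $I(x)=\{F(x)\mid F\in I\}$ and $I_x=\overline{I(x)}$. Then $I_x$ is an isocone of $M_n(\mathbb C)$ for every $x\in M$, and there is a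 partial order $\preceq_M$ on $M$, closed in $M\times M$ and with strict part $\prec_M$, such that for all $x,y\in M$ and $\xi,\eta\in\mathbb CP^{n-1}$: $$(x,\xi)\le_I(y,\eta)\iff x\prec_M y\ \text{ or }\ \bigl(x=y\text{ and }\xi\le_{I_x}\eta\bigr).$$ If moreover $n\ge 2$, then for all $x,y\in M$ $$x\prec_M y\iff \max\sigma(F(x))\le\min\sigma(F(y))\ \text{ for every }F\in I,$$ where $\sigma$ denotes the spectrum, and the strict order $\prec_M$ is closed in $M\times M$. -/

import Mathlib

open scoped Matrix.Norms.L2Operator Pointwise LinearAlgebra.Projectivization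

noncomputable section

/-- A subset `I` of the self-adjoint part of a unital C*-algebra `A` is an isocone when it contains
the real constants, is stable under sums and under the functional calculus by continuous
order-preserving functions `ℝ → ℝ`, is norm closed, and `I - I` is dense in the self-adjoint
part. -/
structure IsIsocone {A : Type*} [CStarAlgebra A] (I : Set A) : Prop where
  isSelfAdjoint : ∀ a ∈ I, IsSelfAdjoint a
  const_mem : ∀ r : ℝ, algebraMap ℝ A r ∈ I
  add_mem : ∀ a ∈ I, ∀ b ∈ I, a + b ∈ I
  cfc_mem : ∀ a ∈ I, ∀ f : ℝ → ℝ, Continuous f → Monotone f → cfc f a ∈ I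
  isClosed : IsClosed I
  closure_sub : closure (I - I) = {a : A | IsSelfAdjoint a}

/-- States of a unital C*-algebra: positive linear functionals with value `1` at the unit. -/
structure CStarState (A : Type*) [CStarAlgebra A] where
  toLinearMap : A →ₗ[ℂ] ℂ
  map_one : toLinearMap 1 = 1
  map_star_mul_self : ∀ a : A, ∃ r : ℝ, 0 ≤ r ∧ toLinearMap (star a * a) = (r : ℂ)

/-- The relation `φ ≤_I ψ` on states: `φ a ≤ ψ a` for all `a ∈ I`. Elements of an isocone are
self-adjoint, so that states take real values on them. -/
def StateLE {A : Type*} [CStarAlgebra A] (I : Set A) (φ ψ : CStarState A) : Prop :=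
  ∀ a ∈ I, (φ.toLinearMap a).re ≤ (ψ.toLinearMap a).re

/-- `max σ(a) ≤ min σ(b)`, with the extrema of the real spectra attained. -/
def MaxSpectrumLEMin {A : Type*} [CStarAlgebra A] (a b : A) : Prop :=
  ∃ s t : ℝ, IsGreatest (spectrum ℝ a) s ∧ IsLeast (spectrum ℝ b) t ∧ s ≤ t

theorem star_dotProduct_self_ne_zero {n : ℕ} {v : Fin n → ℂ} (hv : v ≠ 0) :
    star v ⬝ᵥ v ≠ 0 := by
  open scoped ComplexOrder in
  exact fun h => hv (dotProduct_star_self_eq_zero.mp h)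

/-- The pure state `a ↦ ξ† a ξ` of `M_n(ℂ)` given by a line `ξ ∈ ℂP^{n-1}`; the quotient by the
squared norm makes it independent of the representing vector. -/
def vectorState {n : ℕ} (ξ : ℙ ℂ (Fin n → ℂ)) : CStarState (Matrix (Fin n) (Fin n) ℂ) where
  toLinearMap :=
    { toFun := fun a => (star ξ.rep ⬝ᵥ (a.mulVec ξ.rep)) / (star ξ.rep ⬝ᵥ ξ.rep)
      map_add' := fun a b => by
        rw [Matrix.add_mulVec, dotProduct_add, add_div]
      map_smul' := fun c a => by
        rw [Matrix.smul_mulVec, dotProduct_smul, smul_eq_mul, RingHom.id_apply, smul_eq_mul,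
          mul_div_assoc] }
  map_one := by
    simpa using div_self (star_dotProduct_self_ne_zero ξ.rep_nonzero)
  map_star_mul_self := fun a => by
    have key : ∀ w : Fin n → ℂ, star w ⬝ᵥ w = ((∑ i, Complex.normSq (w i) : ℝ) : ℂ) := by
      intro w
      simp [dotProduct, Complex.normSq_eq_conj_mul_self]
    refine ⟨(∑ i, Complex.normSq (a.mulVec ξ.rep i)) / (∑ i, Complex.normSq (ξ.rep i)),
      div_nonneg (Finset.sum_nonneg fun _ _ => Complex.normSq_nonneg _)
        (Finset.sum_nonneg fun _ _ => Complex.normSq_nonneg _), ?_⟩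
    have h : star ξ.rep ⬝ᵥ ((star a * a).mulVec ξ.rep)
        = star (a.mulVec ξ.rep) ⬝ᵥ a.mulVec ξ.rep := by
      rw [← Matrix.mulVec_mulVec, Matrix.dotProduct_mulVec, Matrix.star_eq_conjTranspose,
        Matrix.star_mulVec]
    change (star ξ.rep ⬝ᵥ ((star a * a).mulVec ξ.rep)) / (star ξ.rep ⬝ᵥ ξ.rep) = _
    rw [h, key, key, Complex.ofReal_div]

/-- On a line represented by a unit vector `v` the state is `a ↦ v† a v`. -/
theorem vectorState_mk_apply {n : ℕ} (v : Fin n → ℂ) (hv : v ≠ 0) (h1 : star v ⬝ᵥ v = 1)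
    (a : Matrix (Fin n) (Fin n) ℂ) :
    (vectorState (Projectivization.mk ℂ v hv)).toLinearMap a = star v ⬝ᵥ a.mulVec v := by
  obtain ⟨c, hc⟩ := Projectivization.exists_smul_eq_mk_rep ℂ v hv
  change (star (Projectivization.mk ℂ v hv).rep ⬝ᵥ (a.mulVec (Projectivization.mk ℂ v hv).rep))
    / (star (Projectivization.mk ℂ v hv).rep ⬝ᵥ (Projectivization.mk ℂ v hv).rep) = _
  rw [← hc]
  have hc0 : (c : ℂ) ≠ 0 := c.ne_zero
  have hs : star (c : ℂ) ≠ 0 := star_ne_zero.mpr hc0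
  simp only [Units.smul_def, star_smul, Matrix.mulVec_smul, smul_dotProduct, dotProduct_smul, h1,
    smul_eq_mul]
  field_simp

/-- The pure state `(x, ξ) : F ↦ ξ† F(x) ξ` of `C(M, M_n(ℂ)) ≅ C(M) ⊗ M_n(ℂ)`. -/
def pureState {M : Type*} [TopologicalSpace M] [CompactSpace M] {n : ℕ}
    (x : M) (ξ : ℙ ℂ (Fin n → ℂ)) : CStarState C(M, Matrix (Fin n) (Fin n) ℂ) where
  toLinearMap :=
    { toFun := fun F => (vectorState ξ).toLinearMap (F x)
      map_add' := fun F G => (vectorState ξ).toLinearMap.map_add (F x) (G x)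
      map_smul' := fun c F => (vectorState ξ).toLinearMap.map_smul c (F x) }
  map_one := (vectorState ξ).map_one
  map_star_mul_self := fun F => (vectorState ξ).map_star_mul_self (F x)

/-- `I_x`, the closure of `I(x) = {F(x) | F ∈ I}`. -/
def localIsocone {M : Type*} [TopologicalSpace M] {n : ℕ}
    (I : Set C(M, Matrix (Fin n) (Fin n) ℂ)) (x : M) : Set (Matrix (Fin n) (Fin n) ℂ) :=
  closure ((fun F => F x) '' I)

end

/-!
Write `x ⊴ y` (`AllStatesLE`) when every vector state at `x` lies below every vector state at `y`
on the isocone `I`. By the variational description of the extreme eigenvalues this says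
`max σ(F x) ≤ min σ(F y)` for all `F ∈ I` (`maxSpectrumLEMin_iff`); it is a closed relation. The
order on `M` is "`x = y` or `x ⊴ y`"; antisymmetry holds because `I - I` is dense, so that `I`
separates the points. When `n ≥ 2`, no point satisfies `x ⊴ x`, since all matrices `F x` would be
scalar, so the strict order is `⊴` itself and is closed.

What remains is that for `x ≠ y` the inequality `(x, ξ) ≤_I (y, η)` for one pair of lines implies
it for all pairs (`allStatesLE_of_ne`). The pairs `(F x, F y)`, `F ∈ I`, form a convex cone `J` of
pairs of Hermitian matrices, stable under the monotone functional calculus. Since `x ≠ y` and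
`I - I` is dense, `J` spans the finite-dimensional space of all such pairs, hence has interior
points there. The conclusion is then the finite-dimensional statement
`expectation_le_of_expectation_le`: if `(a, b)` is an interior point of `J` at which some
eigenvalue of `a` exceeds some eigenvalue of `b`, one can conjugate `a` and `b` independently by
unitaries close to `1` without leaving `J` (`exists_unitary_conj_near`), and a suitable sum of
images of such pairs under a ramp function can be truncated to a pair `(P', 0)` in `J` with
`P' ≥ 0` and `P' ξ ≠ 0`. This contradicts the inequality between the states `ξ` and `η`.

For a single point, the inequality on `I` passes to the closure `I_x` by continuity, and `I_x` is
an isocone because evaluation at `x` is a star homomorphism commuting with the functional calculus.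
-/

noncomputable section

open Matrix

/-! ### Expectations of matrices -/

/-- The real part of `v† a v`; for Hermitian `a` and a unit vector `v` it is the expectation of `a`
in the vector state of `v`. -/
def expectation {n : ℕ} (a : Matrix (Fin n) (Fin n) ℂ) (v : Fin n → ℂ) : ℝ :=
  (star v ⬝ᵥ a *ᵥ v).re

section Expectation

variable {n : ℕ} (a b : Matrix (Fin n) (Fin n) ℂ) (v : Fin n → ℂ)

theorem expectation_add : expectation (a + b) v = expectation a v + expectation b v := by
  simp [expectation, add_mulVec, dotProduct_add]

theorem expectation_sub : expectation (a - b) v = expectation a v - expectation b v := by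
  simp [expectation, sub_mulVec, dotProduct_sub]

theorem expectation_zero : expectation (0 : Matrix (Fin n) (Fin n) ℂ) v = 0 := by
  simp [expectation]

theorem expectation_smul (r : ℝ) : expectation (r • a) v = r * expectation a v := by
  simp [expectation, smul_mulVec, dotProduct_smul]

theorem expectation_sum {ι : Type*} (s : Finset ι) (f : ι → Matrix (Fin n) (Fin n) ℂ) :
    expectation (∑ i ∈ s, f i) v = ∑ i ∈ s, expectation (f i) v := by
  simp [expectation, sum_mulVec, dotProduct_sum]

theorem expectation_one (hv : star v ⬝ᵥ v = 1) :
    expectation (1 : Matrix (Fin n) (Fin n) ℂ) v = 1 := by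
  simp [expectation, hv]

theorem expectation_eigenvector {a : Matrix (Fin n) (Fin n) ℂ} {v : Fin n → ℂ}
    (hv : star v ⬝ᵥ v = 1) {r : ℝ} (h : a *ᵥ v = (r : ℂ) • v) : expectation a v = r := by
  simp [expectation, h, hv]

theorem expectation_algebraMap (hv : star v ⬝ᵥ v = 1) (r : ℝ) :
    expectation (algebraMap ℝ (Matrix (Fin n) (Fin n) ℂ) r) v = r := by
  rw [Algebra.algebraMap_eq_smul_one, expectation_smul, expectation_one v hv, mul_one]

theorem continuous_expectation :
    Continuous fun p : Matrix (Fin n) (Fin n) ℂ × (Fin n → ℂ) => expectation p.1 p.2 := by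
  unfold expectation
  fun_prop

open scoped ComplexOrder in
theorem Matrix.PosSemidef.expectation_nonneg {a : Matrix (Fin n) (Fin n) ℂ} (ha : a.PosSemidef) :
    0 ≤ expectation a v :=
  (Complex.le_def.mp (ha.dotProduct_mulVec_nonneg v)).1

open scoped ComplexOrder in
theorem Matrix.PosSemidef.mulVec_eq_zero_of_expectation {a : Matrix (Fin n) (Fin n) ℂ}
    (ha : a.PosSemidef) {v : Fin n → ℂ} (h : expectation a v = 0) : a *ᵥ v = 0 := by
  rw [← ha.dotProduct_mulVec_zero_iff]
  exact Complex.ext h (Complex.le_def.mp (ha.dotProduct_mulVec_nonneg v)).2.symm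

end Expectation

/-! ### Functional calculus and spectra of Hermitian matrices -/

section FunctionalCalculus

variable {n : ℕ} {a : Matrix (Fin n) (Fin n) ℂ}

theorem cfc_mulVec_eigenvector (ha : IsSelfAdjoint a) (f : ℝ → ℝ) {u : Fin n → ℂ} {r : ℝ}
    (h : a *ᵥ u = (r : ℂ) • u) : cfc f a *ᵥ u = (f r : ℂ) • u := by
  have hH : a.IsHermitian := ha
  have hs := hH.spectral_theorem
  rw [hH.cfc_eq, IsHermitian.cfc, Unitary.conjStarAlgAut_apply]
  rw [Unitary.conjStarAlgAut_apply] at hs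
  set U : Matrix (Fin n) (Fin n) ℂ := (hH.eigenvectorUnitary : Matrix (Fin n) (Fin n) ℂ) with hU
  have hUU : star U * U = 1 := Unitary.coe_star_mul_self hH.eigenvectorUnitary
  have hUU' : U * star U = 1 := Unitary.coe_mul_star_self hH.eigenvectorUnitary
  have hw : u = U *ᵥ (star U *ᵥ u) := by rw [mulVec_mulVec, hUU', one_mulVec]
  set w := star U *ᵥ u with hwd
  have h1 : diagonal (RCLike.ofReal ∘ hH.eigenvalues : Fin n → ℂ) *ᵥ w = (r : ℂ) • w := by
    have : star U *ᵥ (a *ᵥ u) = (r : ℂ) • w := by rw [h, mulVec_smul]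
    rw [← this, mulVec_mulVec]
    conv_rhs => rw [hs]
    rw [mulVec_mulVec, ← mul_assoc, ← mul_assoc, hUU, one_mul]
  have h2 : diagonal (RCLike.ofReal ∘ f ∘ hH.eigenvalues : Fin n → ℂ) *ᵥ w = (f r : ℂ) • w := by
    ext i
    have := congrFun h1 i
    simp only [mulVec_diagonal, Function.comp_apply, Pi.smul_apply, smul_eq_mul,
      Complex.coe_algebraMap] at this ⊢
    rcases mul_eq_mul_right_iff.mp this with h | h
    · rw [Complex.ofReal_injective h]
    · simp [h]
  rw [← mulVec_mulVec, ← mulVec_mulVec, h2, mulVec_smul, ← hw]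

open scoped MatrixOrder ComplexOrder in
theorem posSemidef_cfc {f : ℝ → ℝ} (hf : ∀ t, 0 ≤ f t) : (cfc f a).PosSemidef :=
  Matrix.nonneg_iff_posSemidef.mp (cfc_nonneg fun t _ => hf t)

theorem exists_unit_eigenvector (ha : IsSelfAdjoint a) {r : ℝ} (hr : r ∈ spectrum ℝ a) :
    ∃ u : Fin n → ℂ, star u ⬝ᵥ u = 1 ∧ a *ᵥ u = (r : ℂ) • u := by
  have hH : a.IsHermitian := ha
  rw [hH.spectrum_real_eq_range_eigenvalues] at hr
  obtain ⟨i, rfl⟩ := hr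
  refine ⟨hH.eigenvectorBasis i, ?_, ?_⟩
  · have := hH.eigenvectorBasis.orthonormal.1 i
    have h2 : inner ℂ (hH.eigenvectorBasis i) (hH.eigenvectorBasis i) = (1 : ℂ) := by
      rw [inner_self_eq_norm_sq_to_K, this]; simp
    rw [EuclideanSpace.inner_eq_star_dotProduct, dotProduct_comm] at h2
    exact h2
  · rw [hH.mulVec_eigenvectorBasis]
    rfl

theorem exists_isGreatest_spectrum (hn : 1 ≤ n) (ha : IsSelfAdjoint a) :
    ∃ s, IsGreatest (spectrum ℝ a) s := by
  have hH : a.IsHermitian := ha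
  have : Nonempty (Fin n) := ⟨⟨0, hn⟩⟩
  rw [hH.spectrum_real_eq_range_eigenvalues]
  exact (Set.finite_range _).isCompact.exists_isGreatest (Set.range_nonempty _)

theorem exists_isLeast_spectrum (hn : 1 ≤ n) (ha : IsSelfAdjoint a) :
    ∃ s, IsLeast (spectrum ℝ a) s := by
  have hH : a.IsHermitian := ha
  have : Nonempty (Fin n) := ⟨⟨0, hn⟩⟩
  rw [hH.spectrum_real_eq_range_eigenvalues]
  exact (Set.finite_range _).isCompact.exists_isLeast (Set.range_nonempty _)

open scoped MatrixOrder ComplexOrder in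
theorem expectation_le_of_isGreatest (ha : IsSelfAdjoint a) {s : ℝ}
    (hs : IsGreatest (spectrum ℝ a) s) {v : Fin n → ℂ} (hv : star v ⬝ᵥ v = 1) :
    expectation a v ≤ s := by
  have h : a ≤ algebraMap ℝ _ s := le_algebraMap_of_spectrum_le (fun x hx => hs.2 hx) ha
  have h2 := (Matrix.le_iff.mp h).expectation_nonneg v
  rw [expectation_sub, expectation_algebraMap v hv] at h2
  linarith

open scoped MatrixOrder ComplexOrder in
theorem le_expectation_of_isLeast (ha : IsSelfAdjoint a) {s : ℝ}
    (hs : IsLeast (spectrum ℝ a) s) {v : Fin n → ℂ} (hv : star v ⬝ᵥ v = 1) :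
    s ≤ expectation a v := by
  have h : algebraMap ℝ _ s ≤ a := algebraMap_le_of_le_spectrum (fun x hx => hs.2 hx) ha
  have h2 := (Matrix.le_iff.mp h).expectation_nonneg v
  rw [expectation_sub, expectation_algebraMap v hv] at h2
  linarith

theorem maxSpectrumLEMin_iff (hn : 1 ≤ n) {b : Matrix (Fin n) (Fin n) ℂ} (ha : IsSelfAdjoint a)
    (hb : IsSelfAdjoint b) :
    MaxSpectrumLEMin a b ↔ ∀ v w : Fin n → ℂ, star v ⬝ᵥ v = 1 → star w ⬝ᵥ w = 1 →
      expectation a v ≤ expectation b w := by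
  constructor
  · rintro ⟨s, t, hs, ht, hst⟩ v w hv hw
    exact (expectation_le_of_isGreatest ha hs hv).trans
      (hst.trans (le_expectation_of_isLeast hb ht hw))
  · intro h
    obtain ⟨s, hs⟩ := exists_isGreatest_spectrum hn ha
    obtain ⟨t, ht⟩ := exists_isLeast_spectrum hn hb
    obtain ⟨u, hu, hau⟩ := exists_unit_eigenvector ha hs.1
    obtain ⟨w, hw, hbw⟩ := exists_unit_eigenvector hb ht.1
    refine ⟨s, t, hs, ht, ?_⟩
    have := h u w hu hw
    rwa [expectation_eigenvector hu hau, expectation_eigenvector hw hbw] at this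

end FunctionalCalculus

/-! ### Small unitary perturbations -/

section Perturbation

variable {n : ℕ}

/-- The rank-one perturbation `1 + c p p†` of the identity. It is unitary when `1 + c p† p` has
modulus one, and then multiplies `p` by this phase and fixes the orthogonal complement of `p`. -/
def phaseRotation (p : Fin n → ℂ) (c : ℂ) : Matrix (Fin n) (Fin n) ℂ :=
  1 + c • vecMulVec p (star p)

theorem star_phaseRotation (p : Fin n → ℂ) (c : ℂ) :
    star (phaseRotation p c) = phaseRotation p (star c) := by
  simp [phaseRotation, star_eq_conjTranspose, conjTranspose_vecMulVec]

theorem phaseRotation_mul (p : Fin n → ℂ) (c d : ℂ) :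
    phaseRotation p c * phaseRotation p d
      = phaseRotation p (c + d + c * d * (star p ⬝ᵥ p)) := by
  simp only [phaseRotation, mul_add, add_mul, one_mul, mul_one, smul_mul_assoc, mul_smul_comm,
    vecMulVec_mul_vecMulVec, add_smul, mul_smul]
  ext i j
  simp [vecMulVec_apply]
  ring

theorem phaseRotation_zero (p : Fin n → ℂ) : phaseRotation p 0 = 1 := by simp [phaseRotation]

theorem phaseRotation_mulVec (p : Fin n → ℂ) (c : ℂ) (u : Fin n → ℂ) :
    phaseRotation p c *ᵥ u = u + (c * (star p ⬝ᵥ u)) • p := by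
  simp only [phaseRotation, add_mulVec, one_mulVec, smul_mulVec, vecMulVec_mulVec]
  ext i
  simp
  ring

/-- Conjugating a matrix by a suitable unitary close to the identity moves it as little as desired
and makes the image of a given vector `u` non-orthogonal to a given vector `z`. When `u` is
orthogonal to `z`, rotating the phase along `u + z` works. -/
theorem exists_unitary_conj_near (b : Matrix (Fin n) (Fin n) ℂ) {u z : Fin n → ℂ} (hu : u ≠ 0)
    (hz : z ≠ 0) {ε : ℝ} (hε : 0 < ε) :
    ∃ v : Matrix (Fin n) (Fin n) ℂ, star v * v = 1 ∧ ‖v * b * star v - b‖ < ε ∧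
      star z ⬝ᵥ v *ᵥ u ≠ 0 := by
  by_cases hzu : star z ⬝ᵥ u = 0
  swap
  · exact ⟨1, by simp, by simpa using hε, by simpa using hzu⟩
  have huz : star u ⬝ᵥ z = 0 := by
    rw [star_dotProduct, hzu, star_zero]
  set p := u + z with hp
  have hu1 := star_dotProduct_self_ne_zero hu
  have hz1 := star_dotProduct_self_ne_zero hz
  have hp0 : p ≠ 0 := by
    intro h
    apply hu1
    have : star u ⬝ᵥ p = 0 := by rw [h, dotProduct_zero]
    rwa [hp, dotProduct_add, huz, add_zero] at this
  have hN := star_dotProduct_self_ne_zero hp0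
  set N := star p ⬝ᵥ p with hNd
  have hNs : star N = N := by rw [hNd, ← star_dotProduct]
  let c : ℝ → ℂ := fun t => (Complex.exp (t * Complex.I) - 1) / N
  have hc0 : c 0 = 0 := by simp [c]
  have hcc : Continuous c := by fun_prop
  have hcont : Continuous fun t : ℝ =>
      ‖phaseRotation p (c t) * b * star (phaseRotation p (c t)) - b‖ := by
    unfold phaseRotation
    fun_prop
  have hlim : Filter.Tendsto (fun t : ℝ =>
      ‖phaseRotation p (c t) * b * star (phaseRotation p (c t)) - b‖) (nhds 0) (nhds 0) := by
    have := hcont.tendsto 0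
    simpa only [hc0, phaseRotation_zero, star_one, one_mul, mul_one, sub_self, norm_zero] using this
  have hev := (hlim.mono_left nhdsWithin_le_nhds).eventually_lt_const
    (f := fun t : ℝ => ‖phaseRotation p (c t) * b * star (phaseRotation p (c t)) - b‖)
    (l := nhdsWithin 0 (Set.Ioi 0)) hε
  obtain ⟨t, ht, ht0, htpi⟩ := (hev.and (Ioo_mem_nhdsGT Real.pi_pos)).exists
  have hct : c t ≠ 0 := by
    intro h
    have h1 : Complex.exp (t * Complex.I) = 1 := by
      rcases div_eq_zero_iff.mp h with h | h
      · exact sub_eq_zero.mp h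
      · exact absurd h hN
    have h2 := congrArg Complex.im h1
    rw [Complex.exp_ofReal_mul_I_im, Complex.one_im] at h2
    exact (Real.sin_pos_of_pos_of_lt_pi ht0 htpi).ne' h2
  refine ⟨phaseRotation p (c t), ?_, ht, ?_⟩
  · rw [star_phaseRotation, phaseRotation_mul, ← hNd]
    have h1 : star (Complex.exp (t * Complex.I)) * Complex.exp (t * Complex.I) = 1 := by
      rw [Complex.star_def, ← Complex.exp_conj, ← Complex.exp_add]
      simp
    have : star (c t) + c t + star (c t) * c t * N = 0 := by
      simp only [c, star_div₀, star_sub, star_one, hNs]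
      field_simp
      linear_combination h1
    rw [this, phaseRotation_zero]
  · rw [phaseRotation_mulVec, dotProduct_add, hzu, zero_add, dotProduct_smul, hp, dotProduct_add,
      hzu, zero_add, star_add, add_dotProduct, hzu, add_zero, smul_eq_mul]
    exact mul_ne_zero (mul_ne_zero hct hu1) hz1

end Perturbation

/-! ### Comparing states at two points -/

section TwoPoint

/-- A convex set is a neighbourhood of one of its points relative to its linear span. -/
theorem Convex.exists_forall_mem_span_add_mem {E : Type*} [NormedAddCommGroup E] [NormedSpace ℝ E]
    [FiniteDimensional ℝ E] {S : Set E} (hS : Convex ℝ S) (h0 : (0 : E) ∈ S) :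
    ∃ j ∈ S, ∃ r > 0, ∀ w ∈ Submodule.span ℝ S, ‖w‖ < r → j + w ∈ S := by
  let T : Set (Submodule.span ℝ S) := (Submodule.span ℝ S).subtype ⁻¹' S
  have hT : Convex ℝ T := hS.linear_preimage (Submodule.span ℝ S).subtype
  have h0T : (0 : Submodule.span ℝ S) ∈ T := by simpa [T] using h0
  have hspan : affineSpan ℝ T = ⊤ := by
    rw [AffineSubspace.affineSpan_eq_top_iff_vectorSpan_eq_top_of_nonempty _ _ _ ⟨0, h0T⟩,
      vectorSpan_eq_span_vsub_set_right ℝ h0T]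
    simp only [vsub_eq_sub, sub_zero, Set.image_id']
    exact Submodule.span_span_coe_preimage
  obtain ⟨j, hj⟩ := hT.interior_nonempty_iff_affineSpan_eq_top.mpr hspan
  obtain ⟨r, hr, hb⟩ := Metric.isOpen_iff.mp isOpen_interior j hj
  have hjT : j ∈ T := interior_subset hj
  refine ⟨j, hjT, r, hr, fun w hw hwr => ?_⟩
  have : j + ⟨w, hw⟩ ∈ T := interior_subset (hb (by simpa using! hwr))
  exact this

variable {n : ℕ}

theorem isCompact_unitVectors : IsCompact {z : Fin n → ℂ | star z ⬝ᵥ z = 1} := by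
  refine Metric.isCompact_of_isClosed_isBounded (isClosed_eq (by fun_prop) continuous_const) ?_
  refine (Metric.isBounded_closedBall (x := (0 : Fin n → ℂ)) (r := 1)).subset fun z hz => ?_
  rw [mem_closedBall_zero_iff, pi_norm_le_iff_of_nonneg zero_le_one]
  intro i
  have h : ∑ j, Complex.normSq (z j) = 1 := by
    have : star z ⬝ᵥ z = ((∑ i, Complex.normSq (z i) : ℝ) : ℂ) := by
      simp [dotProduct, Complex.normSq_eq_conj_mul_self]
    rw [Set.mem_ofPred_eq, this] at hz
    exact_mod_cast hz
  have h1 : Complex.normSq (z i) ≤ 1 := h ▸ Finset.single_le_sum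
    (f := fun j => Complex.normSq (z j)) (fun j _ => Complex.normSq_nonneg _) (Finset.mem_univ i)
  rw [Complex.normSq_eq_norm_sq] at h1
  exact (sq_le_one_iff₀ (norm_nonneg _)).mp h1

theorem ne_zero_of_unit {v : Fin n → ℂ} (hv : star v ⬝ᵥ v = 1) : v ≠ 0 := by
  rintro rfl
  simp at hv

theorem IsSelfAdjoint.star_mulVec_dotProduct {a : Matrix (Fin n) (Fin n) ℂ} (ha : IsSelfAdjoint a)
    (v w : Fin n → ℂ) : star (a *ᵥ v) ⬝ᵥ w = star v ⬝ᵥ a *ᵥ w := by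
  rw [star_mulVec, ← star_eq_conjTranspose, ha.star_eq, dotProduct_mulVec]

/-- For `s < t`, the continuous monotone function with values in `[0, 1]` that rises linearly from
`0` at `s` to `1` at `t`. -/
def ramp (s t : ℝ) (x : ℝ) : ℝ := max 0 (min 1 ((x - s) / (t - s)))

theorem continuous_ramp (s t : ℝ) : Continuous (ramp s t) := by
  unfold ramp
  fun_prop

theorem monotone_ramp {s t : ℝ} (h : s < t) : Monotone (ramp s t) := by
  intro x y hxy
  have : 0 < t - s := sub_pos.mpr h
  unfold ramp
  gcongr

theorem ramp_left (s t : ℝ) : ramp s t s = 0 := by simp [ramp]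

theorem ramp_right {s t : ℝ} (h : s < t) : ramp s t t = 1 := by
  simp [ramp, div_self (sub_pos.mpr h).ne']

theorem ramp_le_one (s t x : ℝ) : ramp s t x ≤ 1 := max_le zero_le_one (min_le_left _ _)

open scoped ComplexOrder in
theorem posSemidef_one_sub_cfc_ramp {s t : ℝ} {a : Matrix (Fin n) (Fin n) ℂ}
    (ha : IsSelfAdjoint a) : (1 - cfc (ramp s t) a).PosSemidef := by
  have hc := continuous_ramp s t
  have : 1 - cfc (ramp s t) a = cfc (fun x => 1 - ramp s t x) a := by
    rw [cfc_sub (fun _ => (1 : ℝ)) (ramp s t) a, cfc_const_one ℝ a]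
  rw [this]
  exact posSemidef_cfc fun x => sub_nonneg.mpr (ramp_le_one s t x)

theorem isSelfAdjoint_conj {b v : Matrix (Fin n) (Fin n) ℂ} (hb : IsSelfAdjoint b) :
    IsSelfAdjoint (v * b * star v) := hb.conjugate v

theorem conj_mulVec_eigenvector {b v : Matrix (Fin n) (Fin n) ℂ} (hv : star v * v = 1)
    {u : Fin n → ℂ} {r : ℝ} (h : b *ᵥ u = (r : ℂ) • u) :
    (v * b * star v) *ᵥ (v *ᵥ u) = (r : ℂ) • v *ᵥ u := by
  rw [mulVec_mulVec, mul_assoc, hv, mul_one, ← mulVec_mulVec, h, mulVec_smul]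

open scoped ComplexOrder in
/-- The key step. `J` is a convex cone of pairs of Hermitian matrices, stable under the monotone
functional calculus and spanning all such pairs. If some pair of vector states satisfies
`ξ ≤ η` on `J`, then all pairs of vector states do: otherwise, for a pair `(a, b)` in the interior
of `J`, some eigenvalue `t` of `a` exceeds some eigenvalue `s` of `b`. The pairs `(P, Q)`
obtained by applying a ramp from `s` to `t` to perturbations of `(a, b)` can be chosen with `P`
fixed, having a fixed vector not orthogonal to `ξ`, and with matrices `Q` having no common fixed
vector. Adding finitely many of them gives `(m P, R)` with all eigenvalues of `R` less than `m`,
and truncating below gives a pair `(P', 0)` in `J` with `P' ≥ 0` and `P' ξ ≠ 0`. -/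
theorem expectation_le_of_expectation_le
    {J : Set (Matrix (Fin n) (Fin n) ℂ × Matrix (Fin n) (Fin n) ℂ)}
    (hsa : ∀ p ∈ J, IsSelfAdjoint p.1 ∧ IsSelfAdjoint p.2)
    (hzero : 0 ∈ J) (hadd : ∀ p ∈ J, ∀ q ∈ J, p + q ∈ J)
    (hcfc : ∀ p ∈ J, ∀ f : ℝ → ℝ, Continuous f → Monotone f → (cfc f p.1, cfc f p.2) ∈ J)
    (hspan : ∀ h k : Matrix (Fin n) (Fin n) ℂ, IsSelfAdjoint h → IsSelfAdjoint k →
      (h, k) ∈ Submodule.span ℝ J)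
    {ξ η : Fin n → ℂ} (hξ : star ξ ⬝ᵥ ξ = 1) (hη : star η ⬝ᵥ η = 1)
    (hle : ∀ p ∈ J, expectation p.1 ξ ≤ expectation p.2 η)
    {p : Matrix (Fin n) (Fin n) ℂ × Matrix (Fin n) (Fin n) ℂ} (hp : p ∈ J)
    {v w : Fin n → ℂ} (hv : star v ⬝ᵥ v = 1) (hw : star w ⬝ᵥ w = 1) :
    expectation p.1 v ≤ expectation p.2 w := by
  have hn : 1 ≤ n := by
    rcases Nat.eq_zero_or_pos n with rfl | h
    · simp at hv
    · exact h
  have hsmul : ∀ q ∈ J, ∀ r : ℝ, 0 ≤ r → r • q ∈ J := by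
    intro q hq r hr
    have := hcfc q hq (fun x => r • x) (by fun_prop)
      (fun x y hxy => mul_le_mul_of_nonneg_left hxy hr)
    have h1 := (hsa q hq).1
    have h2 := (hsa q hq).2
    rwa [cfc_smul_id (R := ℝ) r q.1, cfc_smul_id (R := ℝ) r q.2] at this
  have hconv : Convex ℝ J := fun q hq q' hq' r s hr hs _ =>
    hadd _ (hsmul q hq r hr) _ (hsmul q' hq' s hs)
  obtain ⟨j, hjJ, r, hr, hj⟩ := hconv.exists_forall_mem_span_add_mem hzero
  by_contra! hlt
  -- Pass to an interior point `(a, b) = p + ε j` that still violates the inequality.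
  obtain ⟨ε, hε, hεlt⟩ : ∃ ε : ℝ, 0 < ε ∧
      expectation (p.2 + ε • j.2) w < expectation (p.1 + ε • j.1) v := by
    simp only [expectation_add, expectation_smul]
    have hlim : ∀ c d : ℝ, Filter.Tendsto (fun ε : ℝ => c + ε * d) (nhdsWithin 0 (Set.Ioi 0))
        (nhds c) := fun c d => by
      have h : Continuous fun ε : ℝ => c + ε * d := by fun_prop
      simpa using (h.tendsto 0).mono_left nhdsWithin_le_nhds
    obtain ⟨ε, h1, h2⟩ := (((hlim _ _).eventually_lt (hlim _ _) hlt).and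
      (self_mem_nhdsWithin (a := (0 : ℝ)) (s := Set.Ioi 0))).exists
    exact ⟨ε, h2, h1⟩
  set a := p.1 + ε • j.1 with ha_def
  set b := p.2 + ε • j.2 with hb_def
  have habJ : (a, b) ∈ J := hadd p hp _ (hsmul j hjJ ε hε.le)
  have ha : IsSelfAdjoint a := (hsa _ habJ).1
  have hb : IsSelfAdjoint b := (hsa _ habJ).2
  have hball : ∀ a' b', IsSelfAdjoint a' → IsSelfAdjoint b' → ‖a' - a‖ < ε * r →
      ‖b' - b‖ < ε * r → (a', b') ∈ J := by
    intro a' b' ha' hb' h1 h2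
    have hin := hj _ (Submodule.smul_mem _ ε⁻¹ (hspan (a' - a) (b' - b) (ha'.sub ha)
      (hb'.sub hb))) (by
        rw [norm_smul, norm_inv, Real.norm_of_nonneg hε.le, inv_mul_lt_iff₀ hε]
        exact max_lt h1 h2)
    have := hadd p hp _ (hsmul _ hin ε hε.le)
    rw [smul_add, smul_inv_smul₀ hε.ne'] at this
    convert this using 1
    ext1 <;> simp [ha_def, hb_def] <;> abel
  obtain ⟨t, ht⟩ := exists_isGreatest_spectrum hn ha
  obtain ⟨s, hs⟩ := exists_isLeast_spectrum hn hb
  have hst : s < t := (le_expectation_of_isLeast hb hs hw).trans_lt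
    (hεlt.trans_le (expectation_le_of_isGreatest ha ht hv))
  obtain ⟨u, hu, hau⟩ := exists_unit_eigenvector ha ht.1
  obtain ⟨u₀, hu₀, hbu₀⟩ := exists_unit_eigenvector hb hs.1
  have hεr : 0 < ε * r := mul_pos hε hr
  obtain ⟨V, hV, hVa, hVu⟩ := exists_unitary_conj_near a (ne_zero_of_unit hu)
    (ne_zero_of_unit hξ) hεr
  set P := cfc (ramp s t) (V * a * star V) with hP
  have hPu : P *ᵥ (V *ᵥ u) = V *ᵥ u := by
    rw [hP, cfc_mulVec_eigenvector (isSelfAdjoint_conj ha) _ (conj_mulVec_eigenvector hV hau),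
      ramp_right hst, Complex.ofReal_one, one_smul]
  -- The second components that can be paired with `P`.
  let S : Set (Matrix (Fin n) (Fin n) ℂ) :=
    {Q | (P, Q) ∈ J ∧ ∀ z, star z ⬝ᵥ z = 1 → expectation Q z ≤ 1}
  have hS : ∀ z : Fin n → ℂ, star z ⬝ᵥ z = 1 → ∃ Q ∈ S, expectation Q z < 1 := by
    intro z hz
    obtain ⟨W, hW, hWb, hWu⟩ := exists_unitary_conj_near b (ne_zero_of_unit hu₀)
      (ne_zero_of_unit hz) hεr
    have hsaW : IsSelfAdjoint (W * b * star W) := isSelfAdjoint_conj hb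
    set Q := cfc (ramp s t) (W * b * star W) with hQ
    have hQsa : IsSelfAdjoint Q := cfc_predicate _ _
    have hQps : (1 - Q).PosSemidef := posSemidef_one_sub_cfc_ramp hsaW
    have hQ1 : ∀ z, star z ⬝ᵥ z = 1 → expectation Q z ≤ 1 := fun z hz => by
      have := hQps.expectation_nonneg z
      rw [expectation_sub, expectation_one z hz] at this
      linarith
    refine ⟨Q, ⟨hcfc _ (hball _ _ (isSelfAdjoint_conj ha) hsaW hVa hWb) _ (continuous_ramp s t)
      (monotone_ramp hst), hQ1⟩, lt_of_le_of_ne (hQ1 z hz) fun h => hWu ?_⟩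
    have hQz : Q *ᵥ z = z := by
      have := hQps.mulVec_eq_zero_of_expectation (v := z) (by
        rw [expectation_sub, expectation_one z hz, h, sub_self])
      rw [sub_mulVec, one_mulVec, sub_eq_zero] at this
      exact this.symm
    rw [← hQz, hQsa.star_mulVec_dotProduct, hQ, cfc_mulVec_eigenvector hsaW _
      (conj_mulVec_eigenvector hW hbu₀), ramp_left, Complex.ofReal_zero, zero_smul,
      dotProduct_zero]
  obtain ⟨T, hT⟩ := isCompact_unitVectors.elim_finite_subcover
    (fun Q : S => {z : Fin n → ℂ | expectation Q.1 z < 1})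
    (fun Q => isOpen_lt (by
      have := continuous_expectation (n := n)
      exact this.comp (Continuous.prodMk continuous_const continuous_id)) continuous_const)
    (fun z hz => by
      obtain ⟨Q, hQ, h⟩ := hS z hz
      exact Set.mem_iUnion.mpr ⟨⟨Q, hQ⟩, h⟩)
  set R := ∑ Q ∈ T, (Q : Matrix (Fin n) (Fin n) ℂ) with hR
  have hsumJ : ((T.card : ℝ) • P, R) ∈ J := by
    let J' : AddSubmonoid (Matrix (Fin n) (Fin n) ℂ × Matrix (Fin n) (Fin n) ℂ) :=
      { carrier := J, zero_mem' := hzero, add_mem' := fun h h' => hadd _ h _ h' }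
    have : ∑ Q ∈ T, (P, (Q : Matrix (Fin n) (Fin n) ℂ)) ∈ J' :=
      J'.sum_mem fun Q _ => Q.2.1
    rwa [show ∑ Q ∈ T, (P, (Q : Matrix (Fin n) (Fin n) ℂ)) = ((T.card : ℝ) • P, R) by
      ext1 <;> simp [Prod.fst_sum, Prod.snd_sum, hR, Nat.cast_smul_eq_nsmul]] at this
  have hRsa : IsSelfAdjoint R := (hsa _ hsumJ).2
  have hPsa : IsSelfAdjoint ((T.card : ℝ) • P) := (hsa _ hsumJ).1
  obtain ⟨m, hm⟩ := exists_isGreatest_spectrum hn hRsa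
  have hmT : m < T.card := by
    obtain ⟨z, hz, hRz⟩ := exists_unit_eigenvector hRsa hm.1
    rw [← expectation_eigenvector hz hRz, hR, expectation_sum, Finset.cast_card]
    obtain ⟨Q, hQT, hQz⟩ := Set.mem_iUnion₂.mp (hT hz)
    exact Finset.sum_lt_sum (fun Q _ => Q.2.2 z hz) ⟨Q, hQT, hQz⟩
  -- Truncating below at the largest eigenvalue `m` of `R` kills `R` but keeps the eigenvector `V u`
  -- of `P`.
  let g : ℝ → ℝ := fun x => max 0 (x - m)
  have hgc : Continuous g := by fun_prop
  have hgm : Monotone g := fun x y hxy => max_le_max le_rfl (sub_le_sub_right hxy m)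
  have hgR : cfc g R = 0 := by
    rw [← cfc_zero ℝ R]
    refine cfc_congr fun x hx => ?_
    exact max_eq_left (sub_nonpos.mpr (hm.2 hx))
  have hps : (cfc g ((T.card : ℝ) • P)).PosSemidef := posSemidef_cfc fun x => le_max_left _ _
  have hle0 := hle _ (hcfc _ hsumJ g hgc hgm)
  rw [hgR, expectation_zero] at hle0
  have hξ0 := hps.mulVec_eq_zero_of_expectation (le_antisymm hle0 (hps.expectation_nonneg ξ))
  have hgu := cfc_mulVec_eigenvector hPsa g (u := V *ᵥ u) (r := T.card) (by
    rw [smul_mulVec, hPu]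
    rfl)
  have hgsa : IsSelfAdjoint (cfc g ((T.card : ℝ) • P)) := cfc_predicate _ _
  have h0 := hgsa.star_mulVec_dotProduct ξ (V *ᵥ u)
  rw [hξ0, hgu, star_zero, zero_dotProduct, dotProduct_smul, smul_eq_mul] at h0
  refine mul_ne_zero ?_ hVu h0.symm
  have : 0 < g T.card := lt_max_of_lt_right (sub_pos.mpr hmT)
  exact_mod_cast this.ne'

end TwoPoint

/-! ### Isocones of `C(M, M_n(ℂ))` and evaluation at points -/

section Evaluation

theorem IsIsocone.mem_of_isClosed {A : Type*} [CStarAlgebra A] {I S : Set A} (hI : IsIsocone I)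
    (hS : IsClosed S) (hsub : ∀ a ∈ I, ∀ b ∈ I, a - b ∈ S) {a : A} (ha : IsSelfAdjoint a) :
    a ∈ S := by
  have h : a ∈ closure (I - I) := by
    rw [hI.closure_sub]
    exact ha
  refine closure_minimal ?_ hS h
  rintro _ ⟨b, hb, c, hc, rfl⟩
  exact hsub b hb c hc

/-- The continuous functional calculus by a fixed function preserves closures of sets of
self-adjoint elements. -/
theorem cfc_mem_closure_image {A : Type*} [CStarAlgebra A] {S : Set A}
    (hS : ∀ a ∈ S, IsSelfAdjoint a) {f : ℝ → ℝ} (hf : Continuous f) {a : A} (ha : a ∈ closure S) :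
    cfc f a ∈ closure (cfc f '' S) := by
  let X := {a : A // IsSelfAdjoint a}
  have hcl : IsClosed {a : A | IsSelfAdjoint a} := isClosed_eq continuous_star continuous_id
  have hc : Continuous fun a : X => cfc f a.1 :=
    Continuous.cfc_of_mem_nhdsSet (s := Set.univ) f Filter.univ_mem continuous_subtype_val
      (fun a => a.2) hf.continuousOn
  have hon : ContinuousOn (cfc f) {a : A | IsSelfAdjoint a} :=
    continuousOn_iff_continuous_domRestrict.mpr hc
  exact ((hon a (closure_minimal hS hcl ha)).mono hS).mem_closure_image ha

theorem map_cfc_of_continuous {A B : Type*} [CStarAlgebra A] [CStarAlgebra B] (φ : A →⋆ₐ[ℂ] B)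
    (hφ : Continuous φ) {f : ℝ → ℝ} (hf : Continuous f) {a : A} (ha : IsSelfAdjoint a) :
    φ (cfc f a) = cfc f (φ a) :=
  φ.map_cfc f a hf.continuousOn hφ ha (ha.map φ)

variable {M : Type*} [TopologicalSpace M] {n : ℕ}

/-- Evaluation at a point, as a homomorphism of star algebras. -/
def pointEval (n : ℕ) (x : M) :
    C(M, Matrix (Fin n) (Fin n) ℂ) →⋆ₐ[ℂ] Matrix (Fin n) (Fin n) ℂ where
  toFun F := F x
  map_one' := rfl
  map_mul' _ _ := rfl
  map_zero' := rfl
  map_add' _ _ := rfl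
  commutes' _ := rfl
  map_star' _ := rfl

theorem continuous_apply_point (x : M) :
    Continuous fun F : C(M, Matrix (Fin n) (Fin n) ℂ) => F x :=
  continuous_eval_const x

theorem IsSelfAdjoint.apply_point {F : C(M, Matrix (Fin n) (Fin n) ℂ)} (hF : IsSelfAdjoint F)
    (x : M) : IsSelfAdjoint (F x) :=
  hF.map (pointEval n x)

variable [CompactSpace M]

theorem IsIsocone.exists_apply_eq_cfc {I : Set C(M, Matrix (Fin n) (Fin n) ℂ)}
    (hI : IsIsocone I) {F : C(M, Matrix (Fin n) (Fin n) ℂ)} (hF : F ∈ I) {f : ℝ → ℝ}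
    (hf : Continuous f) (hm : Monotone f) : ∃ G ∈ I, ∀ x, G x = cfc f (F x) :=
  ⟨_, hI.cfc_mem F hF f hf hm, fun x => map_cfc_of_continuous (pointEval n x)
    (continuous_apply_point x) hf (hI.isSelfAdjoint F hF)⟩

theorem isIsocone_localIsocone {I : Set C(M, Matrix (Fin n) (Fin n) ℂ)} (hI : IsIsocone I)
    (x : M) : IsIsocone (localIsocone I x) := by
  have hcl : IsClosed {a : Matrix (Fin n) (Fin n) ℂ | IsSelfAdjoint a} :=
    isClosed_eq continuous_star continuous_id
  have himage : ∀ a ∈ (fun F : C(M, Matrix (Fin n) (Fin n) ℂ) => F x) '' I, IsSelfAdjoint a := by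
    rintro _ ⟨F, hF, rfl⟩
    exact (hI.isSelfAdjoint F hF).apply_point x
  have hsa : ∀ a ∈ localIsocone I x, IsSelfAdjoint a := closure_minimal himage hcl
  refine ⟨hsa, fun r => subset_closure ⟨_, hI.const_mem r, rfl⟩, fun a ha b hb => ?_,
    fun a ha f hf hm => ?_, isClosed_closure, ?_⟩
  · refine map_mem_closure₂ continuous_add ha hb ?_
    rintro _ ⟨F, hF, rfl⟩ _ ⟨G, hG, rfl⟩
    exact ⟨F + G, hI.add_mem F hF G hG, rfl⟩
  · refine closure_mono ?_ (cfc_mem_closure_image himage hf ha)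
    rintro _ ⟨_, ⟨F, hF, rfl⟩, rfl⟩
    obtain ⟨G, hG, h⟩ := hI.exists_apply_eq_cfc hF hf hm
    exact ⟨G, hG, h x⟩
  · apply subset_antisymm
    · refine closure_minimal ?_ hcl
      rintro _ ⟨a, ha, b, hb, rfl⟩
      exact (hsa a ha).sub (hsa b hb)
    · intro h hh
      have hF : IsSelfAdjoint (ContinuousMap.const M h) := ContinuousMap.ext fun _ => hh
      refine hI.mem_of_isClosed (S := {F : C(M, Matrix (Fin n) (Fin n) ℂ) |
        F x ∈ closure (localIsocone I x - localIsocone I x)})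
        (isClosed_closure.preimage (continuous_apply_point x)) (fun F hF G hG => ?_) hF
      exact subset_closure (Set.sub_mem_sub (subset_closure (Set.mem_image_of_mem _ hF))
        (subset_closure (Set.mem_image_of_mem _ hG)))

theorem exists_isSelfAdjoint_apply_eq [T2Space M] {x y : M} (hxy : x ≠ y)
    {h k : Matrix (Fin n) (Fin n) ℂ} (hh : IsSelfAdjoint h) (hk : IsSelfAdjoint k) :
    ∃ F : C(M, Matrix (Fin n) (Fin n) ℂ), IsSelfAdjoint F ∧ F x = h ∧ F y = k := by
  obtain ⟨g, hg0, hg1, -⟩ := exists_continuous_zero_one_of_isClosed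
    (isClosed_singleton (x := x)) (isClosed_singleton (x := y)) (by simpa using hxy)
  have hgx : g x = 0 := hg0 rfl
  have hgy : g y = 1 := hg1 rfl
  refine ⟨⟨fun z => (1 - g z) • h + g z • k, by fun_prop⟩, ContinuousMap.ext fun z => ?_, ?_, ?_⟩
  · exact ((IsSelfAdjoint.all (1 - g z)).smul hh).add ((IsSelfAdjoint.all (g z)).smul hk)
  · simp [hgx]
  · simp [hgy]

end Evaluation

/-! ### The order on points -/

section PointOrder

variable {M : Type*} [TopologicalSpace M] {n : ℕ}

/-- Every vector state at `x` lies below every vector state at `y`. -/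
def AllStatesLE (I : Set C(M, Matrix (Fin n) (Fin n) ℂ)) (x y : M) : Prop :=
  ∀ F ∈ I, ∀ v w : Fin n → ℂ, star v ⬝ᵥ v = 1 → star w ⬝ᵥ w = 1 →
    expectation (F x) v ≤ expectation (F y) w

variable {I : Set C(M, Matrix (Fin n) (Fin n) ℂ)}

theorem isClosed_allStatesLE : IsClosed {p : M × M | AllStatesLE I p.1 p.2} := by
  simp only [AllStatesLE, Set.ofPred_forall]
  refine isClosed_iInter fun F => isClosed_iInter fun _ => isClosed_iInter fun v =>
    isClosed_iInter fun w => isClosed_iInter fun _ => isClosed_iInter fun _ => isClosed_le ?_ ?_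
  · exact continuous_expectation.comp
      ((F.continuous.comp continuous_fst).prodMk continuous_const)
  · exact continuous_expectation.comp
      ((F.continuous.comp continuous_snd).prodMk continuous_const)

theorem star_single_dotProduct_single (i : Fin n) :
    star (Pi.single i (1 : ℂ) : Fin n → ℂ) ⬝ᵥ Pi.single i 1 = 1 := by
  simp

theorem AllStatesLE.trans (hn : 1 ≤ n) {x y z : M} (hxy : AllStatesLE I x y)
    (hyz : AllStatesLE I y z) : AllStatesLE I x z := fun F hF v w hv hw =>
  have h := star_single_dotProduct_single (⟨0, hn⟩ : Fin n)
  (hxy F hF v _ hv h).trans (hyz F hF _ w h hw)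

variable [CompactSpace M]

theorem allStatesLE_iff (hn : 1 ≤ n) (hI : IsIsocone I) (x y : M) :
    AllStatesLE I x y ↔ ∀ F ∈ I, MaxSpectrumLEMin (F x) (F y) :=
  forall₂_congr fun F hF => (maxSpectrumLEMin_iff hn ((hI.isSelfAdjoint F hF).apply_point x)
    ((hI.isSelfAdjoint F hF).apply_point y)).symm

/-- An equality between vector states that holds on an isocone holds on all self-adjoint
elements. -/
theorem IsIsocone.expectation_eq (hI : IsIsocone I) {x y : M} {v w : Fin n → ℂ}
    (h : ∀ F ∈ I, expectation (F x) v = expectation (F y) w)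
    {F : C(M, Matrix (Fin n) (Fin n) ℂ)} (hF : IsSelfAdjoint F) :
    expectation (F x) v = expectation (F y) w := by
  have hc : ∀ (x : M) (v : Fin n → ℂ),
      Continuous fun F : C(M, Matrix (Fin n) (Fin n) ℂ) => expectation (F x) v := fun x v =>
    continuous_expectation.comp
      ((continuous_apply_point x).prodMk continuous_const)
  refine hI.mem_of_isClosed (S := {F : C(M, Matrix (Fin n) (Fin n) ℂ) |
    expectation (F x) v = expectation (F y) w})
    (isClosed_eq (hc x v) (hc y w)) (fun F hF G hG => ?_) hF
  rw [Set.mem_ofPred_eq, ContinuousMap.sub_apply, ContinuousMap.sub_apply, expectation_sub,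
    expectation_sub, h F hF, h G hG]

theorem AllStatesLE.antisymm [T2Space M] (hn : 1 ≤ n) (hI : IsIsocone I) {x y : M}
    (hxy : AllStatesLE I x y) (hyx : AllStatesLE I y x) : x = y := by
  by_contra hne
  have hv := star_single_dotProduct_single (⟨0, hn⟩ : Fin n)
  obtain ⟨F, hF, hFx, hFy⟩ := exists_isSelfAdjoint_apply_eq hne
    (IsSelfAdjoint.zero (Matrix (Fin n) (Fin n) ℂ)) (IsSelfAdjoint.one (Matrix (Fin n) (Fin n) ℂ))
  have := hI.expectation_eq (fun F hF => (hxy F hF _ _ hv hv).antisymm (hyx F hF _ _ hv hv)) hF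
  rw [hFx, hFy, expectation_zero, expectation_one _ hv] at this
  exact zero_ne_one this

theorem not_allStatesLE_self (hn : 2 ≤ n) (hI : IsIsocone I) (x : M) : ¬AllStatesLE I x x := by
  intro h
  let i : Fin n := ⟨0, by omega⟩
  let j : Fin n := ⟨1, by omega⟩
  have hij : i ≠ j := by simp [i, j]
  have hi := star_single_dotProduct_single i
  have hj := star_single_dotProduct_single j
  have hE : IsSelfAdjoint (Matrix.single i i (1 : ℂ)) := by
    simp [IsSelfAdjoint, star_eq_conjTranspose]
  have := hI.expectation_eq (fun F hF => (h F hF _ _ hi hj).antisymm (h F hF _ _ hj hi))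
    (F := ContinuousMap.const M (Matrix.single i i (1 : ℂ))) (ContinuousMap.ext fun _ => hE)
  simp [expectation, hij] at this

/-- At distinct points, comparability of one pair of vector states implies comparability of all. -/
theorem allStatesLE_of_ne [T2Space M] (hI : IsIsocone I) {x y : M} (hne : x ≠ y)
    {ξ η : Fin n → ℂ} (hξ : star ξ ⬝ᵥ ξ = 1) (hη : star η ⬝ᵥ η = 1)
    (hle : ∀ F ∈ I, expectation (F x) ξ ≤ expectation (F y) η) : AllStatesLE I x y := by
  let J : Set (Matrix (Fin n) (Fin n) ℂ × Matrix (Fin n) (Fin n) ℂ) :=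
    (fun F : C(M, Matrix (Fin n) (Fin n) ℂ) => (F x, F y)) '' I
  intro F hF v w hv hw
  refine expectation_le_of_expectation_le (J := J) ?_ ?_ ?_ ?_ ?_ hξ hη ?_ (p := (F x, F y))
    ⟨F, hF, rfl⟩ hv hw
  · rintro _ ⟨F, hF, rfl⟩
    exact ⟨(hI.isSelfAdjoint F hF).apply_point x, (hI.isSelfAdjoint F hF).apply_point y⟩
  · refine ⟨_, hI.const_mem 0, ?_⟩
    simp
  · rintro _ ⟨F, hF, rfl⟩ _ ⟨G, hG, rfl⟩
    exact ⟨F + G, hI.add_mem F hF G hG, rfl⟩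
  · rintro _ ⟨F, hF, rfl⟩ f hf hm
    obtain ⟨G, hG, h⟩ := hI.exists_apply_eq_cfc hF hf hm
    exact ⟨G, hG, Prod.ext (h x) (h y)⟩
  · intro h k hh hk
    obtain ⟨G, hG, rfl, rfl⟩ := exists_isSelfAdjoint_apply_eq hne hh hk
    refine hI.mem_of_isClosed (S := {G : C(M, Matrix (Fin n) (Fin n) ℂ) |
      (G x, G y) ∈ Submodule.span ℝ J}) ?_ ?_ hG
    · exact (Submodule.closed_of_finiteDimensional (Submodule.span ℝ J)).preimage
        ((continuous_apply_point x).prodMk (continuous_apply_point y))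
    · intro G hG H hH
      exact Submodule.sub_mem _ (Submodule.subset_span (Set.mem_image_of_mem _ hG))
        (Submodule.subset_span (Set.mem_image_of_mem _ hH))
  · rintro _ ⟨F, hF, rfl⟩
    exact hle F hF

theorem exists_unit_representative (ξ : ℙ ℂ (Fin n → ℂ)) :
    ∃ v : Fin n → ℂ, star v ⬝ᵥ v = 1 ∧
      ∀ a, ((vectorState ξ).toLinearMap a).re = expectation a v := by
  have hN : star ξ.rep ⬝ᵥ ξ.rep = ((∑ i, Complex.normSq (ξ.rep i) : ℝ) : ℂ) := by
    simp [dotProduct, Complex.normSq_eq_conj_mul_self]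
  have hN0 := star_dotProduct_self_ne_zero ξ.rep_nonzero
  set N : ℝ := ∑ i, Complex.normSq (ξ.rep i) with hNdef
  have hNpos : 0 < N := lt_of_le_of_ne (Finset.sum_nonneg fun _ _ => Complex.normSq_nonneg _)
    fun h => hN0 (by rw [hN, ← h, Complex.ofReal_zero])
  let c : ℂ := ((Real.sqrt N)⁻¹ : ℝ)
  have hc0 : c ≠ 0 := Complex.ofReal_ne_zero.mpr (inv_ne_zero (Real.sqrt_pos.mpr hNpos).ne')
  have h1 : star (c • ξ.rep) ⬝ᵥ (c • ξ.rep) = 1 := by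
    have hr : (Real.sqrt N)⁻¹ * ((Real.sqrt N)⁻¹ * N) = 1 := by
      have := Real.mul_self_sqrt hNpos.le
      have h2 := (Real.sqrt_pos.mpr hNpos).ne'
      field_simp
      rw [sq, this]
    rw [star_smul, smul_dotProduct, dotProduct_smul, hN, smul_eq_mul, smul_eq_mul,
      Complex.star_def, Complex.conj_ofReal]
    rw [← Complex.ofReal_mul, ← Complex.ofReal_mul, hr, Complex.ofReal_one]
  have hv0 : c • ξ.rep ≠ 0 := smul_ne_zero hc0 ξ.rep_nonzero
  have hmk : Projectivization.mk ℂ (c • ξ.rep) hv0 = ξ := by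
    conv_rhs => rw [← ξ.mk_rep]
    exact (Projectivization.mk_eq_mk_iff' ℂ _ _ hv0 ξ.rep_nonzero).mpr ⟨c, rfl⟩
  refine ⟨c • ξ.rep, h1, fun a => ?_⟩
  have := vectorState_mk_apply (c • ξ.rep) hv0 h1 a
  rw [hmk] at this
  rw [this, expectation]

theorem stateLE_localIsocone_iff (x : M) (ξ η : ℙ ℂ (Fin n → ℂ)) :
    StateLE (localIsocone I x) (vectorState ξ) (vectorState η) ↔
      StateLE I (pureState x ξ) (pureState x η) := by
  refine ⟨fun h F hF => h _ (subset_closure ⟨F, hF, rfl⟩), fun h => ?_⟩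
  have hc : ∀ ζ : ℙ ℂ (Fin n → ℂ), Continuous fun a => ((vectorState ζ).toLinearMap a).re :=
    fun ζ => Complex.continuous_re.comp (LinearMap.continuous_of_finiteDimensional _)
  refine closure_minimal (s := (fun F : C(M, Matrix (Fin n) (Fin n) ℂ) => F x) '' I)
    (t := {a | ((vectorState ξ).toLinearMap a).re ≤ ((vectorState η).toLinearMap a).re}) ?_
    (isClosed_le (hc ξ) (hc η))
  rintro _ ⟨F, hF, rfl⟩
  exact h F hF

/-- The partial order on `M` induced by an isocone of `C(M, M_n(ℂ))`: distinct points `x`, `y`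
satisfy `x < y` when all vector states at `x` lie below all vector states at `y`. -/
@[reducible]
def pointOrder [T2Space M] (hn : 1 ≤ n) (hI : IsIsocone I) : PartialOrder M where
  le x y := x = y ∨ AllStatesLE I x y
  le_refl x := Or.inl rfl
  le_trans := by
    rintro x y z (rfl | hxy) (rfl | hyz)
    exacts [Or.inl rfl, Or.inr hyz, Or.inr hxy, Or.inr (hxy.trans hn hyz)]
  le_antisymm := by
    rintro x y (rfl | hxy) (h | hyx)
    exacts [rfl, rfl, h.symm, hxy.antisymm hn hI hyx]

theorem pointOrder_lt_iff [T2Space M] (hn : 1 ≤ n) (hI : IsIsocone I) (x y : M) :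
    (pointOrder hn hI).lt x y ↔ x ≠ y ∧ AllStatesLE I x y := by
  rw [(pointOrder hn hI).lt_iff_le_not_ge]
  constructor
  · rintro ⟨rfl | h, h'⟩
    · exact absurd (Or.inl rfl) h'
    · exact ⟨fun e => h' (Or.inl e.symm), h⟩
  · rintro ⟨hne, h⟩
    refine ⟨Or.inr h, ?_⟩
    rintro (e | h')
    · exact hne e.symm
    · exact hne (h.antisymm hn hI h')

end PointOrder

end

theorem mainTheorem3 {M : Type*} [TopologicalSpace M] [CompactSpace M] [T2Space M]
    (n : ℕ) (hn : 1 ≤ n) (I : Set C(M, Matrix (Fin n) (Fin n) ℂ)) (hI : IsIsocone I) :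
    (∀ x : M, IsIsocone (localIsocone I x)) ∧
    ∃ o : PartialOrder M,
      IsClosed {p : M × M | o.le p.1 p.2} ∧
      (∀ (x y : M) (ξ η : ℙ ℂ (Fin n → ℂ)),
        StateLE I (pureState x ξ) (pureState y η) ↔
          (o.lt x y ∨ (x = y ∧ StateLE (localIsocone I x) (vectorState ξ) (vectorState η)))) ∧
      (2 ≤ n →
        (∀ x y : M, o.lt x y ↔ ∀ F ∈ I, MaxSpectrumLEMin (F x) (F y)) ∧
        IsClosed {p : M × M | o.lt p.1 p.2}) := by
  refine ⟨isIsocone_localIsocone hI, pointOrder hn hI, ?_, fun x y ξ η => ?_, fun hn2 => ?_⟩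
  · exact isClosed_diagonal.union isClosed_allStatesLE
  · rw [pointOrder_lt_iff]
    obtain ⟨v, hv, hξ⟩ := exists_unit_representative ξ
    obtain ⟨w, hw, hη⟩ := exists_unit_representative η
    have hiff : StateLE I (pureState x ξ) (pureState y η) ↔
        ∀ F ∈ I, expectation (F x) v ≤ expectation (F y) w :=
      forall₂_congr fun F _ => by
        rw [← hξ, ← hη]
        rfl
    by_cases hxy : x = y
    · subst hxy
      simp [stateLE_localIsocone_iff]
    · rw [hiff]
      refine ⟨fun h => Or.inl ⟨hxy, allStatesLE_of_ne hI hxy hv hw h⟩, ?_⟩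
      rintro (⟨-, h⟩ | ⟨e, -⟩)
      · exact fun F hF => h F hF v w hv hw
      · exact absurd e hxy
  · have hlt : ∀ x y, (pointOrder hn hI).lt x y ↔ AllStatesLE I x y := fun x y => by
      rw [pointOrder_lt_iff, and_iff_right_iff_imp]
      rintro h rfl
      exact not_allStatesLE_self hn2 hI _ h
    refine ⟨fun x y => (hlt x y).trans (allStatesLE_iff hn hI x y), ?_⟩
    simp only [hlt]
    exact isClosed_allStatesLE
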